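/- **Theorem (Fluctuations in the Euler regime).** A point $(x,v,r)\in\mathbb R^3$ represents a particle at position $x$ at time $0$, with velocity $v$ and mark (rod length) $r$; its space-time line is $\ell(x,v)=\{(x+vt,t):t\in\mathbb R\}$. For $a,b\in\mathbb R^2$ let $ab$ be the set of $(x,v,r)$ such that $\ell(x,v)$ meets the closed segment with extremes $a$ and $b$. Let $\mu$ be a Borel measure on $\mathbb R^3$, let $d\mu_2(x,v,r)=r^2\,d\mu(x,v,r)$, and assume $\mu(ab)+\mu_2(ab)<\infty$ for all $a,b\in\mathbb R^2$. Put $\mathrm d(a,b)=\mu_2(ab)$ and assume $\mathrm d(a,a)=0$ for every $a\in\mathbb R^2$. For a measure $\nu$ on $\mathbb R^3$ let $$m_0^x(\nu)=\iiint r'\bigl(\mathbf 1\{0\le x'<x\}-\mathbf 1\{x\le x'<0\}\bigr)\,d\nu(x',v',r'),$$ $$j_\nu(x,v;t)=\iiint r'\bigl(\mathbf 1\{x'>x,\;x'+tv'<x+vt\}-\mathbf 1\{x'<x,\;x'+tv'>x+vt\}\bigr)\,d\nu(x',v',r'),$$ $$y_\nu(x,v;t)=x+m_0^x(\nu)+vt+j_\nu(x,v;t),$$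 and let $\nu_t$ be the image of $\nu$ under $(x,v,r)\mapsto(x+vt,v,r)$. Thus, when $\nu$ is the empirical measure of a configuration, $y_\nu(x,v;t)$ is the position at time $t$ of the tagged hard-rod quasi-particle with velocity $v$ started at $x+m_0^x(\nu)$. For $\varepsilon>0$ let $N[X^\varepsilon]=\sum_{p\in X^\varepsilon}\delta_p$ be the empirical measure of a Poisson process $X^\varepsilon$ with intensity measure $\varepsilon^{-1}\mu$, and let $N^\varepsilon=\varepsilon N[X^\varepsilon]$. Let $\eta$ be the Lévy–Chentsov field (multitime Brownian field) with distance $\mathrm d$, that is, the centered Gaussian process $(\eta(a))_{a\in\mathbb R^2}$ with covariances $\mathrm{Cov}(\eta(a),\eta(b))=\tfrac12\bigl(\mathrm d(o,a)+\mathrm d(o,b)-\mathrm d(a,b)\bigr)$, where $o=(0,0)$. Then, as $\varepsilon\to0$, $$\varepsilon^{-1/2}\bigl(y_{N^\varepsilon}(x,v;t)-y_\mu(x,v;t)\bigr)\;\longrightarrow\;\eta(x+vt,t),$$ $$\varepsilon^{-1/2}\bigl(\varepsilon\, m_0^x(N[X^\varepsilon]_t)-m_0^x(\mu_t)\bigr)\;\longrightarrow\;\eta(x,t)-\eta(0,t)$$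 jointly in law, in the sense of finite-dimensional distributions: for every finite family of triples $(x_i,v_i,t_i)$ and every finite family of pairs $(z_k,s_k)$, the random vector formed by the left-hand sides of the first display at the $(x_i,v_i,t_i)$ and of the second display at $(x,t)=(z_k,s_k)$ converges in law to the vector formed by the corresponding right-hand sides, all of them taken from the same field $\eta$. -/

import Mathlib

open MeasureTheory ProbabilityTheory Filter Topology
open scoped ENNReal NNReal

noncomputable section

namespace HardRod

/-- A point `(x, v, r)`: a particle at position `x` at time `0`, with velocity `v`, carrying the
mark (rod length) `r`. -/
abbrev Particle : Type := ℝ × ℝ × ℝ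

/-- The space-time line `ℓ(x, v) = {(x + v t, t) : t ∈ ℝ}`. -/
def line (x v : ℝ) : Set (ℝ × ℝ) := Set.range fun t : ℝ => (x + v * t, t)

/-- The set `ab` of points `(x, v, r)` whose line `ℓ(x, v)` meets the closed segment with
extremes `a` and `b`. -/
def crossing (a b : ℝ × ℝ) : Set Particle :=
  {p | (line p.1 p.2.1 ∩ segment ℝ a b).Nonempty}

/-- The measure `dμ₂ = r² dμ`. -/
def secondMark (μ : Measure Particle) : Measure Particle :=
  μ.withDensity fun p => ENNReal.ofReal (p.2.2 ^ 2)

/-- The class `𝓜` of measures with `μ(ab) + μ₂(ab) < ∞` for all space-time points `a, b`. -/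
def IsAdmissible (μ : Measure Particle) : Prop :=
  ∀ a b : ℝ × ℝ, μ (crossing a b) + secondMark μ (crossing a b) < ∞

/-- `d(a, b) = μ₂(ab)`. -/
def crossingDist (μ : Measure Particle) (a b : ℝ × ℝ) : ℝ :=
  (secondMark μ (crossing a b)).toReal

/-- The measure `N[X] = ∑_{p ∈ X} δ_p` of an at most countable configuration `X` of points
(possibly repeated). -/
def IsEmpiricalMeasure (ν : Measure Particle) : Prop :=
  ∃ (ι : Type) (_ : Countable ι) (X : ι → Particle), ν = Measure.sum fun i => Measure.dirac (X i)

/-- `N` is the empirical measure of a Poisson process with intensity measure `Λ`. -/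
structure IsPoissonProcess {Ω : Type*} [MeasurableSpace Ω] (N : Ω → Measure Particle)
    (Λ : Measure Particle) (P : Measure Ω) : Prop where
  measurable : Measurable N
  isEmpiricalMeasure : ∀ ω, IsEmpiricalMeasure (N ω)
  map_eq : ∀ A : Set Particle, MeasurableSet A → Λ A < ∞ →
    P.map (fun ω => N ω A) = (poissonMeasure (Λ A).toNNReal).map (Nat.cast : ℕ → ℝ≥0∞)
  indep : ∀ (n : ℕ) (A : Fin n → Set Particle), (∀ i, MeasurableSet (A i)) →
    Pairwise (Function.onFun Disjoint A) → iIndepFun (fun i ω => N ω (A i)) P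

/-- The rescaled empirical measure `N^ε φ = ε ∑_{p ∈ X^ε} φ(p)`, where `N` is the empirical measure
of `X^ε`. -/
def rescale (ε : ℝ) (N : Measure Particle) : Measure Particle := ENNReal.ofReal ε • N

/-- The free (ideal gas) motion `(x, v, r) ↦ (x + v t, v, r)`. -/
def freeMotion (t : ℝ) (p : Particle) : Particle := (p.1 + p.2.1 * t, p.2.1, p.2.2)

/-- The ideal gas at time `t`: the measure `ν_t`, image of `ν` under the free motion. For an
empirical measure `N[X]` it is the empirical measure of `T_t X`. -/
def evolve (t : ℝ) (ν : Measure Particle) : Measure Particle := ν.map (freeMotion t)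

/-- The signed length
`m_z^x(ν) = ∫ r (1{z ≤ x' < x} - 1{x ≤ x' < z}) dν(x', v', r)` between `z` and `x`. -/
def mass (ν : Measure Particle) (z x : ℝ) : ℝ :=
  ∫ p, p.2.2 * ((Set.Ico z x).indicator 1 p.1 - (Set.Ico x z).indicator 1 p.1) ∂ν

/-- The length flow `j_ν(x, v; t)` across the line `ℓ(x, v)` between times `0` and `t`:
`∫ r' (1{x' > x, x' + t v' < x + v t} - 1{x' < x, x' + t v' > x + v t}) dν(x', v', r')`. -/
def flow (ν : Measure Particle) (x v t : ℝ) : ℝ :=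
  ∫ p, p.2.2 *
    (Set.indicator {q : Particle | x < q.1 ∧ q.1 + t * q.2.1 < x + v * t} 1 p -
      Set.indicator {q : Particle | q.1 < x ∧ x + v * t < q.1 + t * q.2.1} 1 p) ∂ν

/-- The position at time `t` of the tagged quasi-particle started at `x + m_0^x(ν)` with
velocity `v`: `y_ν(x, v; t) = x + m_0^x(ν) + v t + j_ν(x, v; t)`. -/
def quasiParticle (ν : Measure Particle) (x v t : ℝ) : ℝ :=
  x + mass ν 0 x + v * t + flow ν x v t

/-- `η` is a Lévy–Chentsov field (multitime Brownian field) with distance `d`: a centered Gaussian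
process on the space-time plane with
`Cov(η(a), η(b)) = (d(o, a) + d(o, b) - d(a, b)) / 2`, `o` being the origin. -/
structure IsLevyChentsovField {Ω : Type*} [MeasurableSpace Ω] (η : ℝ × ℝ → Ω → ℝ)
    (d : ℝ × ℝ → ℝ × ℝ → ℝ) (P : Measure Ω) : Prop where
  isGaussianProcess : IsGaussianProcess η P
  centered : ∀ a, ∫ ω, η a ω ∂P = 0
  covariance_eq : ∀ a b, cov[η a, η b; P] = (d 0 a + d 0 b - d a b) / 2

end HardRod

end

open HardRod

/-! All observables are linear in the measure. Let `1_a` indicate that a particle's line passes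
strictly to the left of `a`. The functions `signedMark a b = r (1_b - 1_a)` telescope. The ideal-gas
mass at time `s` is the integral of such an increment from `(0, s)` to `(z, s)`. Mass plus flow
along the broken path from `o` through `(x, 0)` to `(x + v t, t)` collapses to the increment from
`o` to the endpoint (`quasiParticle_eq`). Lines through a fixed point are harmless: since `d(a, a) =
0`, almost all of them carry mark zero, for `μ` and almost surely for the Poisson configurations.

What remains is a central limit theorem for Poisson integrals of linear combinations `F` of signed
marks. By the Poisson characteristic functional (`charFun_integral`), the fluctuation has
log-characteristic function `∫ (e^{i√ε F} - 1 - i√ε F) / ε dμ`, which tends to `-½ ∫ F² dμ` by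
dominated convergence. Since `d(a, b) = ∫ (signedMark a b)² dμ`, polarization
(`integral_signedMark_mul`) shows that the same combination of increments of `η` has variance `∫ F²
dμ`. Lévy's continuity theorem concludes. -/

namespace HardRod

/-! ### Lines, segments and signed marks -/

/-- The signed distance at time `a.2` from the line of `p` to the space-time point `a`. -/
noncomputable def displacement (a : ℝ × ℝ) (p : Particle) : ℝ := a.1 - (p.1 + p.2.1 * a.2)

/-- The indicator of the particles whose line passes strictly to the left of `a`. -/
noncomputable def leftIndicator (a : ℝ × ℝ) (p : Particle) : ℝ :=
  if 0 < displacement a p then 1 else 0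

/-- The mark of `p`, counted with sign, if the line of `p` separates `a` from `b`. -/
noncomputable def signedMark (a b : ℝ × ℝ) (p : Particle) : ℝ :=
  p.2.2 * (leftIndicator b p - leftIndicator a p)

/-- For fixed `p` the displacement is affine in `a`, so it vanishes somewhere on a segment exactly
when its endpoint values do not have the same strict sign. -/
lemma crossing_eq (a b : ℝ × ℝ) :
    crossing a b = {p | displacement a p * displacement b p ≤ 0} := by
  ext p
  simp only [crossing, line, Set.mem_ofPred_eq]
  constructor
  · rintro ⟨q, ⟨t, rfl⟩, α, β, hα, hβ, hαβ, h⟩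
    have h1 : α * a.1 + β * b.1 = p.1 + p.2.1 * t := congrArg Prod.fst h
    have h2 : α * a.2 + β * b.2 = t := congrArg Prod.snd h
    have h3 : α * displacement a p + β * displacement b p = 0 := by
      unfold displacement
      linear_combination h1 - p.2.1 * h2 - p.1 * hαβ
    have h4 : displacement a p * displacement b p
        = -(β * displacement b p ^ 2 + α * displacement a p ^ 2) := by
      linear_combination (-(displacement a p * displacement b p)) * hαβ
        + (displacement b p + displacement a p) * h3
    rw [h4]
    have := mul_nonneg hβ (sq_nonneg (displacement b p))
    have := mul_nonneg hα (sq_nonneg (displacement a p))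
    linarith
  · intro h
    by_cases hab : displacement b p - displacement a p = 0
    · have ha : displacement a p = 0 := by
        have : displacement b p = displacement a p := by linarith
        rw [this] at h
        nlinarith [sq_nonneg (displacement a p)]
      refine ⟨a, ⟨a.2, ?_⟩, left_mem_segment ℝ a b⟩
      unfold displacement at ha
      exact Prod.ext (by dsimp only; linarith) rfl
    · set D := displacement b p - displacement a p with hD
      have hD2 : 0 < D ^ 2 := by positivity
      -- The barycentric weights of the zero of the affine function. They are nonnegative because
      -- `h` makes both numerators, multiplied by `D`, nonnegative.
      set α := displacement b p / D with hα
      set β := -displacement a p / D with hβ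
      have hα0 : 0 ≤ α := by
        have : α = displacement b p * D / D ^ 2 := by rw [hα]; field_simp
        rw [this]
        apply div_nonneg _ hD2.le
        nlinarith [sq_nonneg (displacement b p)]
      have hβ0 : 0 ≤ β := by
        have : β = -displacement a p * D / D ^ 2 := by rw [hβ]; field_simp
        rw [this]
        apply div_nonneg _ hD2.le
        nlinarith [sq_nonneg (displacement a p)]
      have hαβ : α + β = 1 := by
        rw [hα, hβ, ← add_div, ← sub_eq_add_neg, ← hD, div_self hab]
      have hz : α * displacement a p + β * displacement b p = 0 := by
        rw [hα, hβ]; field_simp; ring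
      refine ⟨α • a + β • b, ⟨α * a.2 + β * b.2, ?_⟩, α, β, hα0, hβ0, hαβ, rfl⟩
      unfold displacement at hz
      refine Prod.ext ?_ (by simp)
      simp only [Prod.fst_add, Prod.smul_fst, smul_eq_mul]
      linear_combination -hz - p.1 * hαβ

@[fun_prop]
lemma measurable_displacement (a : ℝ × ℝ) : Measurable (displacement a) := by
  unfold displacement
  fun_prop

@[fun_prop]
lemma measurable_leftIndicator (a : ℝ × ℝ) : Measurable (leftIndicator a) :=
  Measurable.ite (measurableSet_lt measurable_const (measurable_displacement a))
    measurable_const measurable_const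

@[fun_prop]
lemma measurable_signedMark (a b : ℝ × ℝ) : Measurable (signedMark a b) := by
  unfold signedMark
  fun_prop

lemma measurableSet_crossing (a b : ℝ × ℝ) : MeasurableSet (crossing a b) := by
  rw [crossing_eq]
  exact measurableSet_le (by fun_prop) measurable_const

lemma support_signedMark_subset (a b : ℝ × ℝ) :
    Function.support (signedMark a b) ⊆ crossing a b := by
  intro p hp
  rw [crossing_eq]
  by_contra h
  apply hp
  have h' : 0 < displacement a p * displacement b p := not_le.1 h
  rcases pos_and_pos_or_neg_and_neg_of_mul_pos h' with ⟨ha, hb⟩ | ⟨ha, hb⟩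
  · simp [signedMark, leftIndicator, ha, hb]
  · simp [signedMark, leftIndicator, ha.not_gt, hb.not_gt]

lemma abs_signedMark_le (a b : ℝ × ℝ) (p : Particle) : |signedMark a b p| ≤ |p.2.2| := by
  unfold signedMark leftIndicator
  split_ifs <;> simp

lemma signedMark_add (a b c : ℝ × ℝ) (p : Particle) :
    signedMark a b p + signedMark b c p = signedMark a c p := by
  unfold signedMark
  ring

lemma IsAdmissible.measure_crossing_lt_top {μ : Measure Particle} (hμ : IsAdmissible μ)
    (a b : ℝ × ℝ) : μ (crossing a b) < ∞ :=
  (le_self_add).trans_lt (hμ a b)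

lemma secondMark_crossing (μ : Measure Particle) (a b : ℝ × ℝ) :
    secondMark μ (crossing a b) = ∫⁻ p in crossing a b, ENNReal.ofReal (p.2.2 ^ 2) ∂μ :=
  withDensity_apply _ (measurableSet_crossing a b)

lemma IsAdmissible.memLp_signedMark {μ : Measure Particle} (hμ : IsAdmissible μ)
    (a b : ℝ × ℝ) : MemLp (signedMark a b) 2 μ := by
  rw [memLp_two_iff_integrable_sq (measurable_signedMark a b).aestronglyMeasurable,
    ← integrableOn_iff_integrable_of_support_subset (s := crossing a b)]
  · have h : IntegrableOn (fun p : Particle => p.2.2 ^ 2) (crossing a b) μ := by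
      refine ⟨by fun_prop, ?_⟩
      rw [hasFiniteIntegral_iff_ofReal (ae_of_all _ fun p => sq_nonneg _),
        ← secondMark_crossing]
      exact (le_add_self).trans_lt (hμ a b)
    refine h.mono' (by fun_prop) (ae_of_all _ fun p => ?_)
    rw [Real.norm_eq_abs, abs_of_nonneg (sq_nonneg _)]
    exact sq_le_sq.2 (abs_signedMark_le a b p)
  · intro p hp
    apply support_signedMark_subset
    intro h
    simp [h] at hp

lemma IsAdmissible.integrable_signedMark {μ : Measure Particle} (hμ : IsAdmissible μ)
    (a b : ℝ × ℝ) : Integrable (signedMark a b) μ := by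
  rw [← integrableOn_iff_integrable_of_support_subset (support_signedMark_subset a b)]
  have : IsFiniteMeasure (μ.restrict (crossing a b)) :=
    ⟨by simpa using hμ.measure_crossing_lt_top a b⟩
  exact ((hμ.memLp_signedMark a b).restrict _).integrable (by norm_num)

/-! ### The distance as a squared `L²` norm, and its polarization -/

/-- `ν`-almost every particle whose line passes through `a` has mark zero. -/
def IsMarkless (ν : Measure Particle) (a : ℝ × ℝ) : Prop :=
  ∀ᵐ p ∂ν, displacement a p = 0 → p.2.2 = 0

/-- The degenerate segment `aa` is crossed exactly by the lines through `a`, so the integral of `r²`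
over these lines vanishes. -/
lemma IsAdmissible.isMarkless {μ : Measure Particle} (hμ : IsAdmissible μ) {a : ℝ × ℝ}
    (ha : crossingDist μ a a = 0) : IsMarkless μ a := by
  have h0 : secondMark μ (crossing a a) = 0 := by
    rcases (ENNReal.toReal_eq_zero_iff _).1 ha with h | h
    · exact h
    · exact absurd h ((le_add_self).trans_lt (hμ a a)).ne
  rw [secondMark_crossing, lintegral_eq_zero_iff (by fun_prop), Filter.EventuallyEq,
    ae_restrict_iff' (measurableSet_crossing a a)] at h0
  filter_upwards [h0] with p hp hpa
  have h1 : ENNReal.ofReal (p.2.2 ^ 2) = 0 := hp (by rw [crossing_eq]; simp [hpa])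
  rw [ENNReal.ofReal_eq_zero] at h1
  exact pow_eq_zero_iff (two_ne_zero) |>.1 (le_antisymm h1 (sq_nonneg _))

/-- The closed condition defining `crossing a b` and strict separation differ only on lines through
`a` or `b`, which almost everywhere have mark zero. -/
lemma crossingDist_eq_integral {μ : Measure Particle} {a b : ℝ × ℝ} (ha : IsMarkless μ a)
    (hb : IsMarkless μ b) :
    crossingDist μ a b = ∫ p, signedMark a b p ^ 2 ∂μ := by
  rw [crossingDist, secondMark_crossing, ← lintegral_indicator (measurableSet_crossing a b),
    integral_eq_lintegral_of_nonneg_ae (ae_of_all _ fun p => sq_nonneg _) (by fun_prop)]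
  congr 1
  apply lintegral_congr_ae
  filter_upwards [ha, hb] with p hpa hpb
  classical
  by_cases hr : p.2.2 = 0
  · simp [signedMark, hr]
  have ha' : displacement a p ≠ 0 := fun h => hr (hpa h)
  have hb' : displacement b p ≠ 0 := fun h => hr (hpb h)
  rw [Set.indicator_apply, crossing_eq, Set.mem_ofPred_eq]
  unfold signedMark leftIndicator
  rcases lt_or_gt_of_ne ha' with h | h <;> rcases lt_or_gt_of_ne hb' with h' | h'
  · simp [h.not_gt, h'.not_gt, mul_pos_of_neg_of_neg h h']
  · simp [h.not_gt, h', (mul_neg_of_neg_of_pos h h').le]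
  · simp [h, h'.not_gt, (mul_neg_of_pos_of_neg h h').le]
  · simp [h, h', mul_pos h h']

/-- Polarization of four squares. Only differences `r (1_b - 1_a)` occur, because a single `r 1_a`
need not be square integrable. -/
lemma integral_signedMark_mul {μ : Measure Particle} (hμ : IsAdmissible μ)
    (hd : ∀ a : ℝ × ℝ, crossingDist μ a a = 0) (a b a' b' : ℝ × ℝ) :
    ∫ p, signedMark a b p * signedMark a' b' p ∂μ
      = (crossingDist μ b a' + crossingDist μ a b' - crossingDist μ b b'
          - crossingDist μ a a') / 2 := by
  have hm a := hμ.isMarkless (hd a)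
  have hi a b : Integrable (fun p => signedMark a b p ^ 2) μ :=
    (hμ.memLp_signedMark a b).integrable_sq
  simp only [fun a b => crossingDist_eq_integral (hm a) (hm b)]
  rw [← integral_add (hi _ _) (hi _ _), ← integral_sub (by fun_prop) (hi _ _),
    ← integral_sub (by fun_prop) (hi _ _), ← integral_div]
  congr 1 with p
  unfold signedMark
  ring

/-! ### Masses, flows and positions as integrals of signed marks -/

lemma mass_zero_eq (ν : Measure Particle) (x : ℝ) :
    mass ν 0 x = ∫ p, signedMark 0 (x, 0) p ∂ν := by
  unfold mass
  congr 1 with p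
  simp only [signedMark, leftIndicator, displacement, Set.indicator_apply, Set.mem_Ico,
    Prod.fst_zero, Prod.snd_zero, Pi.one_apply]
  congr 1
  rcases lt_or_ge p.1 0 with h | h <;> rcases lt_or_ge p.1 x with h' | h' <;>
    simp [h, h', not_le.2, not_lt.2]

lemma mass_evolve_eq (ν : Measure Particle) (z s : ℝ) :
    mass (evolve s ν) 0 z = ∫ p, signedMark (0, s) (z, s) p ∂ν := by
  have hmeas : Measurable (freeMotion s) := by
    unfold freeMotion
    fun_prop
  rw [mass_zero_eq, evolve, integral_map hmeas.aemeasurable (by fun_prop)]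
  congr 1 with p
  simp [signedMark, leftIndicator, displacement, freeMotion]

/-- Unlike the half-open intervals of the mass, the flow is strict at both ends; the two
descriptions agree off the lines through the endpoints. -/
lemma flow_eq {ν : Measure Particle} {x v t : ℝ} (h₀ : IsMarkless ν (x, 0))
    (h₁ : IsMarkless ν (x + v * t, t)) :
    flow ν x v t = ∫ p, signedMark (x, 0) (x + v * t, t) p ∂ν := by
  unfold flow
  apply integral_congr_ae
  filter_upwards [h₀, h₁] with p hp hp'
  by_cases hr : p.2.2 = 0
  · simp [signedMark, hr]
  simp only [signedMark]
  congr 1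
  have hp : x ≠ p.1 := by
    have := mt hp hr
    simpa [displacement, sub_eq_zero] using this
  have hp' : x + v * t ≠ p.1 + t * p.2.1 := by
    have := mt hp' hr
    simpa [displacement, sub_eq_zero, mul_comm] using this
  simp only [leftIndicator, displacement, Set.indicator_apply, Set.mem_ofPred_eq, Pi.one_apply,
    mul_zero, add_zero, sub_pos, mul_comm p.2.1 t]
  rcases lt_or_gt_of_ne hp with h | h <;> rcases lt_or_gt_of_ne hp' with h' | h' <;>
    simp [h, h', h.not_gt, h'.not_gt]

lemma quasiParticle_eq {ν : Measure Particle} {x v t : ℝ} (h₀ : IsMarkless ν (x, 0))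
    (h₁ : IsMarkless ν (x + v * t, t)) (hi : Integrable (signedMark 0 (x, 0)) ν)
    (hi' : Integrable (signedMark (x, 0) (x + v * t, t)) ν) :
    quasiParticle ν x v t = x + v * t + ∫ p, signedMark 0 (x + v * t, t) p ∂ν := by
  have h : ∫ p, signedMark 0 (x + v * t, t) p ∂ν
      = (∫ p, signedMark 0 (x, 0) p ∂ν) + ∫ p, signedMark (x, 0) (x + v * t, t) p ∂ν := by
    rw [← integral_add hi hi']
    simp only [signedMark_add]
  rw [quasiParticle, mass_zero_eq, flow_eq h₀ h₁, h]
  ring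

/-! ### Campbell's formula and the Poisson characteristic functional -/

section Poisson

variable {Ω : Type*} [MeasurableSpace Ω] {N : Ω → Measure Particle} {Λ : Measure Particle}
  {P : Measure Ω}

lemma lintegral_natCast_poissonMeasure (r : ℝ≥0) :
    ∫⁻ n : ℕ, (n : ℝ≥0∞) ∂poissonMeasure r = r := by
  have hs : HasSum (fun n : ℕ => Real.exp (-r) * (r : ℝ) ^ n / (n.factorial : ℝ) * n) (r : ℝ) := by
    rw [← hasSum_nat_add_iff' 1]
    have h := (hasSum_one_poissonMeasure r).mul_left (r : ℝ)
    simp only [Finset.range_one, Finset.sum_singleton, Nat.cast_zero, mul_zero, sub_zero]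
    rw [mul_one] at h
    have heq (n : ℕ) : Real.exp (-r) * (r : ℝ) ^ (n + 1) / ((n + 1).factorial : ℝ)
        * ((n + 1 : ℕ) : ℝ) = r * (Real.exp (-r) * (r : ℝ) ^ n / (n.factorial : ℝ)) := by
      rw [Nat.factorial_succ, pow_succ]
      push_cast
      field_simp
    simpa only [heq] using h
  rw [poissonMeasure, lintegral_sum_measure]
  simp only [lintegral_smul_measure, lintegral_dirac]
  have hr : (r : ℝ≥0∞) = ENNReal.ofReal
      (∑' n : ℕ, Real.exp (-r) * (r : ℝ) ^ n / (n.factorial : ℝ) * n) := by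
    rw [hs.tsum_eq, ENNReal.ofReal_coe_nnreal]
  rw [hr, ENNReal.ofReal_tsum_of_nonneg (fun n => by positivity) hs.summable]
  congr 1 with n
  rw [ENNReal.ofReal_mul (by positivity), ENNReal.ofReal_natCast, smul_eq_mul]

namespace IsPoissonProcess

lemma lintegral_apply (h : IsPoissonProcess N Λ P) {A : Set Particle} (hA : MeasurableSet A)
    (hΛ : Λ A < ∞) : ∫⁻ ω, N ω A ∂P = Λ A := by
  have hm : Measurable fun ω => N ω A := (Measure.measurable_coe hA).comp h.measurable
  calc ∫⁻ ω, N ω A ∂P = ∫⁻ x, x ∂(P.map fun ω => N ω A) :=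
        (lintegral_map measurable_id hm).symm
    _ = Λ A := by
        rw [h.map_eq A hA hΛ, lintegral_map (f := fun x => x) measurable_id .of_discrete,
          lintegral_natCast_poissonMeasure]
        exact ENNReal.coe_toNNReal hΛ.ne

/-- Campbell's formula, at the level of measures. -/
lemma restrict_bind (h : IsPoissonProcess N Λ P) {S : Set Particle} (hS : MeasurableSet S)
    (hΛ : Λ S < ∞) : (P.bind N).restrict S = Λ.restrict S := by
  ext A hA
  rw [Measure.restrict_apply hA, Measure.restrict_apply hA,
    Measure.bind_apply (hA.inter hS) h.measurable.aemeasurable,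
    h.lintegral_apply (hA.inter hS) ((measure_mono Set.inter_subset_right).trans_lt hΛ)]

lemma ae_ae (h : IsPoissonProcess N Λ P) {S : Set Particle} (hS : MeasurableSet S)
    (hΛ : Λ S < ∞) {q : Particle → Prop} (hq : ∀ᵐ p ∂Λ, q p) (hqS : ∀ p, p ∉ S → q p) :
    ∀ᵐ ω ∂P, ∀ᵐ p ∂N ω, q p := by
  apply Measure.ae_ae_of_ae_bind h.measurable.aemeasurable
  have h1 : ∀ᵐ p ∂(P.bind N).restrict S, q p := by
    rw [h.restrict_bind hS hΛ]
    exact ae_restrict_of_ae hq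
  filter_upwards [(ae_restrict_iff' hS).1 h1] with p hp
  by_cases hpS : p ∈ S
  exacts [hp hpS, hqS p hpS]

/-- By Campbell's formula `∫ |F| dN` has finite mean, hence is almost surely finite. -/
lemma integrable_ae (h : IsPoissonProcess N Λ P) {S : Set Particle} (hS : MeasurableSet S)
    (hΛ : Λ S < ∞) {F : Particle → ℝ} (hFm : Measurable F) (hF : Integrable F Λ)
    (hFS : Function.support F ⊆ S) : ∀ᵐ ω ∂P, Integrable F (N ω) := by
  have h1 : Integrable F (P.bind N) := by
    rw [← integrableOn_iff_integrable_of_support_subset hFS, IntegrableOn,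
      h.restrict_bind hS hΛ]
    exact hF.restrict
  have h2 : ∫⁻ ω, ∫⁻ p, ‖F p‖ₑ ∂N ω ∂P < ∞ := by
    rw [← Measure.lintegral_bind h.measurable.aemeasurable (by fun_prop)]
    exact h1.2
  have h3 : Measurable fun ω => ∫⁻ p, ‖F p‖ₑ ∂N ω :=
    (Measure.measurable_lintegral (by fun_prop)).comp h.measurable
  filter_upwards [ae_lt_top h3 h2.ne] with ω hω
  exact ⟨hFm.aestronglyMeasurable, hω⟩

lemma aemeasurable_integral (h : IsPoissonProcess N Λ P) {F : Particle → ℝ} (hFm : Measurable F)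
    (hF : ∀ᵐ ω ∂P, Integrable F (N ω)) : AEMeasurable (fun ω => ∫ p, F p ∂N ω) P := by
  have h3 (G : Particle → ℝ) (hG : Measurable G) :
      Measurable fun ω => ∫⁻ p, ENNReal.ofReal (G p) ∂N ω :=
    (Measure.measurable_lintegral (by fun_prop)).comp h.measurable
  refine ⟨fun ω => (∫⁻ p, ENNReal.ofReal (F p) ∂N ω).toReal
    - (∫⁻ p, ENNReal.ofReal (-F p) ∂N ω).toReal,
    (h3 F hFm).ennreal_toReal.sub (h3 _ hFm.neg).ennreal_toReal, ?_⟩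
  filter_upwards [hF] with ω hω
  exact integral_eq_lintegral_pos_part_sub_lintegral_neg_part hω

lemma charFun_apply_set (h : IsPoissonProcess N Λ P) {A : Set Particle} (hA : MeasurableSet A)
    (hΛ : Λ A < ∞) (y : ℝ) :
    ∫ ω, Complex.exp (((N ω).real A * y : ℝ) * Complex.I) ∂P
      = Complex.exp (Λ.real A * (Complex.exp (y * Complex.I) - 1)) := by
  have hm : Measurable fun ω => N ω A := (Measure.measurable_coe hA).comp h.measurable
  calc ∫ ω, Complex.exp (((N ω).real A * y : ℝ) * Complex.I) ∂P
      = ∫ x, Complex.exp ((x.toReal * y : ℝ) * Complex.I) ∂(P.map fun ω => N ω A) :=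
        (integral_map (f := fun x : ℝ≥0∞ => Complex.exp ((x.toReal * y : ℝ) * Complex.I))
          hm.aemeasurable (by fun_prop)).symm
    _ = charFun ((poissonMeasure (Λ A).toNNReal).map (Nat.cast : ℕ → ℝ)) y := by
        rw [h.map_eq A hA hΛ, charFun_apply_real, integral_map .of_discrete (by fun_prop),
          integral_map .of_discrete (by fun_prop)]
        congr 1 with n
        simp [mul_comm]
    _ = _ := by
        rw [charFun_map_cast_poissonMeasure]
        rfl

lemma charFun_simpleFunc (h : IsPoissonProcess N Λ P) {S : Set Particle} (hS : MeasurableSet S)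
    (hΛ : Λ S < ∞) (f : SimpleFunc Particle ℝ) (hf : Integrable f Λ)
    (hfS : Function.support f ⊆ S) :
    ∫ ω, Complex.exp ((∫ p, f p ∂N ω : ℝ) * Complex.I) ∂P
      = Complex.exp (∫ p, (Complex.exp (f p * Complex.I) - 1) ∂Λ) := by
  -- The level set of the value zero is dropped: it may have infinite intensity, and it contributes
  -- nothing. The others are disjoint, so their counts are independent Poisson variables.
  set T : Finset ℝ := f.range.filter (· ≠ 0) with hT
  let e := T.equivFin.symm
  let A : Fin T.card → Set Particle := fun i => f ⁻¹' {(e i : ℝ)}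
  have hA i : MeasurableSet (A i) := f.measurableSet_fiber _
  have hne i : (e i : ℝ) ≠ 0 := (Finset.mem_filter.1 (e i).2).2
  have hAΛ i : Λ (A i) < ∞ := by
    refine (measure_mono ?_).trans_lt hΛ
    intro p hp
    apply hfS
    have : f p = e i := hp
    rw [Function.mem_support, this]
    exact hne i
  have hdisj : Pairwise (Function.onFun Disjoint A) := by
    intro i j hij
    refine Disjoint.preimage _ ?_
    rw [Set.disjoint_singleton]
    exact fun hc => hij (e.injective (Subtype.ext hc))
  have hsum {M : Type} [AddCommMonoid M] (g : ℝ → M) (hg : ∀ y, y = 0 → g y = 0) :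
      ∑ y ∈ f.range, g y = ∑ y ∈ T, g y :=
    (Finset.sum_filter_of_ne fun y _ hy => mt (hg y) hy).symm
  have hind := h.indep _ A hA hdisj
  have hint : ∀ᵐ ω ∂P, Complex.exp ((∫ p, f p ∂N ω : ℝ) * Complex.I)
      = ∏ i, Complex.exp (((N ω).real (A i) * e i : ℝ) * Complex.I) := by
    filter_upwards [h.integrable_ae hS hΛ f.measurable hf hfS] with ω hω
    rw [← SimpleFunc.integral_eq_integral f hω, SimpleFunc.integral_eq, ← Complex.exp_sum,
      ← Finset.sum_mul]
    congr 2
    rw [← Complex.ofReal_sum]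
    congr 1
    rw [hsum _ fun y hy => by simp [hy], ← Finset.sum_coe_sort T]
    exact (Equiv.sum_comp e fun y => (N ω).real (f ⁻¹' {(y : ℝ)}) * (y : ℝ)).symm
  have hprod := hind.integral_fun_prod_comp (𝕜 := ℂ)
    (f := fun i x => Complex.exp ((x.toReal * e i : ℝ) * Complex.I))
    (fun i => ((Measure.measurable_coe (hA i)).comp h.measurable).aemeasurable)
    (fun i => by fun_prop)
  have hg : Integrable (fun p => Complex.exp (f p * Complex.I) - 1) Λ := by
    refine hf.norm.mono' (by fun_prop) (ae_of_all _ fun p => ?_)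
    rw [mul_comm]
    exact Real.norm_exp_I_mul_ofReal_sub_one_le
  rw [integral_congr_ae hint]
  refine hprod.trans ?_
  have hone i := h.charFun_apply_set (hA i) (hAΛ i) (e i)
  refine (Finset.prod_congr rfl fun i _ => hone i).trans ?_
  rw [← Complex.exp_sum]
  congr 1
  have hmap : ∫ p, (Complex.exp (f p * Complex.I) - 1) ∂Λ
      = ∑ y ∈ f.range, Λ.real (f ⁻¹' {y}) • (Complex.exp (y * Complex.I) - 1) := by
    rw [← SimpleFunc.map_integral f (fun y : ℝ => Complex.exp (y * Complex.I) - 1) hf (by simp),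
      SimpleFunc.integral_eq_integral _ (by simpa [Function.comp_def] using hg)]
    simp
  rw [hmap, hsum _ fun y hy => by simp [hy], ← Finset.sum_coe_sort T]
  simp only [Complex.real_smul]
  exact Equiv.sum_comp e fun y =>
    (Λ.real (f ⁻¹' {(y : ℝ)}) : ℂ) * (Complex.exp ((y : ℝ) * Complex.I) - 1)

/-- The characteristic functional of a Poisson process. -/
lemma charFun_integral [IsProbabilityMeasure P] (h : IsPoissonProcess N Λ P) {S : Set Particle}
    (hS : MeasurableSet S) (hΛ : Λ S < ∞) {F : Particle → ℝ} (hFm : Measurable F)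
    (hF : Integrable F Λ) (hFS : Function.support F ⊆ S) :
    ∫ ω, Complex.exp ((∫ p, F p ∂N ω : ℝ) * Complex.I) ∂P
      = Complex.exp (∫ p, (Complex.exp (F p * Complex.I) - 1) ∂Λ) := by
  -- Approximation starting from the value `0` keeps `|f n| ≤ 2 |F|` and the support inside `S`;
  -- this dominates both sides of the identity for simple functions.
  let f : ℕ → SimpleFunc Particle ℝ := SimpleFunc.approxOn F hFm Set.univ 0 (Set.mem_univ _)
  have hbd n p : ‖f n p‖ ≤ ‖F p‖ + ‖F p‖ := SimpleFunc.norm_approxOn_zero_le hFm _ p n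
  have hlim p : Tendsto (fun n => f n p) atTop (𝓝 (F p)) :=
    SimpleFunc.tendsto_approxOn hFm _ (by simp)
  have hfS n : Function.support (f n) ⊆ S := by
    refine subset_trans (fun p hp => ?_) hFS
    intro hc
    apply hp
    simpa [hc] using hbd n p
  have hfi n {ν : Measure Particle} (hν : Integrable F ν) : Integrable (f n) ν :=
    (hν.norm.add hν.norm).mono' (by fun_prop) (ae_of_all _ (hbd n))
  have haei := h.integrable_ae hS hΛ hFm hF hFS
  have hL : Tendsto (fun n => ∫ ω, Complex.exp ((∫ p, f n p ∂N ω : ℝ) * Complex.I) ∂P) atTop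
      (𝓝 (∫ ω, Complex.exp ((∫ p, F p ∂N ω : ℝ) * Complex.I) ∂P)) := by
    refine tendsto_integral_of_dominated_convergence (fun _ => 1) (fun n => ?_)
      (integrable_const _) (fun n => ae_of_all _ fun ω => ?_) ?_
    · have := h.aemeasurable_integral (f n).measurable (haei.mono fun ω hω => hfi n hω)
      exact (by fun_prop : AEMeasurable _ P).aestronglyMeasurable
    · rw [Complex.norm_exp_ofReal_mul_I]
    · filter_upwards [haei] with ω hω
      have h1 : Tendsto (fun n => ∫ p, f n p ∂N ω) atTop (𝓝 (∫ p, F p ∂N ω)) :=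
        tendsto_integral_of_dominated_convergence (fun p => ‖F p‖ + ‖F p‖)
          (fun n => by fun_prop) (hω.norm.add hω.norm) (fun n => ae_of_all _ (hbd n))
          (ae_of_all _ hlim)
      exact (Continuous.tendsto (f := fun x : ℝ => Complex.exp (x * Complex.I))
        (by fun_prop) _).comp h1
  have hR : Tendsto (fun n => ∫ ω, Complex.exp ((∫ p, f n p ∂N ω : ℝ) * Complex.I) ∂P) atTop
      (𝓝 (Complex.exp (∫ p, (Complex.exp (F p * Complex.I) - 1) ∂Λ))) := by
    simp only [fun n => h.charFun_simpleFunc hS hΛ (f n) (hfi n hF) (hfS n)]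
    refine (Complex.continuous_exp.tendsto _).comp ?_
    refine tendsto_integral_of_dominated_convergence (fun p => ‖F p‖ + ‖F p‖)
      (fun n => by fun_prop) (hF.norm.add hF.norm) (fun n => ae_of_all _ fun p => ?_)
      (ae_of_all _ fun p => ?_)
    · rw [mul_comm]
      exact Real.norm_exp_I_mul_ofReal_sub_one_le.trans (hbd n p)
    · exact (Continuous.tendsto (f := fun x : ℝ => Complex.exp (x * Complex.I) - 1)
        (by fun_prop) _).comp (hlim p)
  exact tendsto_nhds_unique hL hR

end IsPoissonProcess

end Poisson

/-! ### Second-order asymptotics of the compensated exponent -/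

/-- A quadratic bound valid for all `x`: at `x = δ F`, division by `δ²` leaves the dominating
function `2 F²`, free of `δ`. -/
lemma norm_exp_mul_I_sub_one_sub_le (x : ℝ) :
    ‖Complex.exp (x * Complex.I) - 1 - x * Complex.I‖ ≤ 2 * x ^ 2 := by
  have hn : ‖(x : ℂ) * Complex.I‖ = |x| := by simp
  rcases le_total |x| 1 with h | h
  · have := Complex.norm_exp_sub_one_sub_id_le (hn.le.trans h)
    rw [hn, sq_abs] at this
    nlinarith [sq_nonneg x]
  · have h1 : ‖Complex.exp (x * Complex.I) - 1‖ ≤ |x| := by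
      rw [mul_comm]
      exact Real.norm_exp_I_mul_ofReal_sub_one_le
    refine (norm_sub_le _ _).trans ?_
    rw [hn, ← sq_abs]
    nlinarith

lemma tendsto_exp_mul_I_sub_one_sub_div_sq (y : ℝ) :
    Tendsto (fun δ : ℝ => (Complex.exp ((δ * y : ℝ) * Complex.I) - 1 - (δ * y : ℝ) * Complex.I)
      / (δ : ℂ) ^ 2) (𝓝[>] 0) (𝓝 (-((y ^ 2 : ℝ) : ℂ) / 2)) := by
  have h0 : Tendsto (fun δ : ℝ => ((δ * y : ℝ) : ℂ) * Complex.I) (𝓝 0) (𝓝 0) := by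
    have : Continuous fun δ : ℝ => ((δ * y : ℝ) : ℂ) * Complex.I := by fun_prop
    simpa using this.tendsto 0
  have h1 := (Complex.exp_sub_sum_range_succ_isLittleO_pow 2).comp_tendsto h0
  have h2 : (fun δ : ℝ => (((δ * y : ℝ) : ℂ) * Complex.I) ^ 2)
      =O[𝓝 0] fun δ : ℝ => (δ : ℂ) ^ 2 := by
    refine Asymptotics.IsBigO.of_bound (y ^ 2) (Eventually.of_forall fun δ => ?_)
    simp only [Complex.norm_mul, norm_pow, Complex.norm_real, Complex.norm_I, mul_one,
      Real.norm_eq_abs, sq_abs]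
    exact le_of_eq (by ring)
  have h3 := (h1.trans_isBigO h2).tendsto_div_nhds_zero.mono_left
    (nhdsWithin_le_nhds (s := Set.Ioi (0 : ℝ)))
  rw [← zero_add (-((y ^ 2 : ℝ) : ℂ) / 2)]
  refine (h3.add_const _).congr' ?_
  filter_upwards [self_mem_nhdsWithin] with δ hδ
  have hδ' : (δ : ℂ) ≠ 0 := by exact_mod_cast (ne_of_gt hδ)
  simp only [Function.comp_apply, Finset.sum_range_succ, Finset.sum_range_zero]
  field_simp
  push_cast
  simp only [mul_pow, Complex.I_sq]
  simp [Nat.factorial]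
  ring

lemma tendsto_integral_exp_sub_one_sub {μ : Measure Particle} {F : Particle → ℝ}
    (hFm : Measurable F) (hF : MemLp F 2 μ) :
    Tendsto (fun δ : ℝ => ∫ p, (Complex.exp ((δ * F p : ℝ) * Complex.I) - 1
      - (δ * F p : ℝ) * Complex.I) / (δ : ℂ) ^ 2 ∂μ) (𝓝[>] 0)
      (𝓝 (-((∫ p, F p ^ 2 ∂μ : ℝ) : ℂ) / 2)) := by
  have hlim : -((∫ p, F p ^ 2 ∂μ : ℝ) : ℂ) / 2 = ∫ p, -((F p ^ 2 : ℝ) : ℂ) / 2 ∂μ := by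
    rw [integral_div, integral_neg, integral_complex_ofReal]
  rw [hlim]
  refine tendsto_integral_filter_of_dominated_convergence (fun p => 2 * F p ^ 2)
    (Eventually.of_forall fun δ => by fun_prop) ?_ (hF.integrable_sq.const_mul 2)
    (ae_of_all _ fun p => tendsto_exp_mul_I_sub_one_sub_div_sq (F p))
  filter_upwards [self_mem_nhdsWithin] with δ hδ
  refine ae_of_all _ fun p => ?_
  have hδ' : 0 < δ := hδ
  rw [norm_div, norm_pow, Complex.norm_real, Real.norm_eq_abs, sq_abs,
    div_le_iff₀ (by positivity)]
  refine (norm_exp_mul_I_sub_one_sub_le _).trans (le_of_eq (by ring))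

/-- The fluctuation `ε^{-1/2} (N^ε F - μ F)`. -/
noncomputable def fluctuation (μ N : Measure Particle) (ε : ℝ) (F : Particle → ℝ) : ℝ :=
  ε ^ (-(1 / 2) : ℝ) * (ε * ∫ p, F p ∂N - ∫ p, F p ∂μ)

lemma charFun_fluctuation {Ω : Type*} [MeasurableSpace Ω] {N : Ω → Measure Particle}
    {P : Measure Ω} [IsProbabilityMeasure P] {μ : Measure Particle} {ε : ℝ} (hε : 0 < ε)
    (h : IsPoissonProcess N (ENNReal.ofReal ε⁻¹ • μ) P) {S : Set Particle}
    (hS : MeasurableSet S) (hμS : μ S < ∞) {F : Particle → ℝ} (hFm : Measurable F)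
    (hF : Integrable F μ) (hFS : Function.support F ⊆ S) :
    ∫ ω, Complex.exp (fluctuation μ (N ω) ε F * Complex.I) ∂P
      = Complex.exp (∫ p, (Complex.exp ((√ε * F p : ℝ) * Complex.I) - 1
          - (√ε * F p : ℝ) * Complex.I) / (√ε : ℂ) ^ 2 ∂μ) := by
  have hδ : 0 < √ε := Real.sqrt_pos.2 hε
  have hδ2 : √ε ^ 2 = ε := Real.sq_sqrt hε.le
  have hpow : ε ^ (-(1 / 2) : ℝ) = (√ε)⁻¹ := by
    rw [Real.rpow_neg hε.le, Real.sqrt_eq_rpow]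
  have hchar := h.charFun_integral (F := fun p => √ε * F p) hS
    (by simpa using ENNReal.mul_lt_top ENNReal.ofReal_lt_top hμS) (by fun_prop)
    ((hF.const_mul _).smul_measure ENNReal.ofReal_ne_top)
    ((Function.support_const_smul_subset (√ε) F).trans hFS)
  -- Since `ε^{-1/2} ε = √ε`, the random part is the Poisson integral of `√ε F`; the deterministic
  -- centering supplies the compensator `-i √ε F` in the exponent.
  have hsplit ω : Complex.exp (fluctuation μ (N ω) ε F * Complex.I)
      = Complex.exp ((∫ p, √ε * F p ∂N ω : ℝ) * Complex.I)
        * Complex.exp (-((√ε)⁻¹ * ∫ p, F p ∂μ : ℝ) * Complex.I) := by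
    rw [← Complex.exp_add, ← add_mul]
    congr 2
    rw [integral_const_mul, fluctuation, hpow, ← Complex.ofReal_neg, ← Complex.ofReal_add]
    congr 1
    nth_rw 2 [← hδ2]
    field_simp
    ring
  simp only [hsplit]
  rw [integral_mul_const, hchar, ← Complex.exp_add]
  congr 1
  have hi : Integrable (fun p => Complex.exp ((√ε * F p : ℝ) * Complex.I) - 1) μ := by
    refine (hF.const_mul (√ε)).norm.mono' (by fun_prop) (ae_of_all _ fun p => ?_)
    rw [mul_comm]
    exact Real.norm_exp_I_mul_ofReal_sub_one_le
  have hi' : Integrable (fun p => ((√ε * F p : ℝ) : ℂ) * Complex.I) μ :=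
    (hF.const_mul (√ε)).ofReal.mul_const _
  rw [integral_smul_measure, integral_div, integral_sub hi hi', integral_mul_const,
    integral_complex_ofReal, integral_const_mul, ENNReal.toReal_ofReal (by positivity),
    ← Complex.ofReal_pow, hδ2, Complex.real_smul]
  have hε' : (ε : ℂ) ≠ 0 := by exact_mod_cast hε.ne'
  have hδ' : (√ε : ℂ) ≠ 0 := by exact_mod_cast hδ.ne'
  have hδ2' : (√ε : ℂ) ^ 2 = ε := by exact_mod_cast hδ2
  generalize ∫ p, (Complex.exp ((√ε * F p : ℝ) * Complex.I) - 1) ∂μ = J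
  push_cast
  rw [← hδ2']
  field_simp
  ring

/-! ### Gaussian increments of the Lévy–Chentsov field -/

lemma integral_sum_smul_signedMark_sq {μ : Measure Particle} (hμ : IsAdmissible μ)
    {K : Type*} [Fintype K] (a b : K → ℝ × ℝ) (c : K → ℝ) :
    ∫ p, (∑ k, c k * signedMark (a k) (b k) p) ^ 2 ∂μ
      = ∑ k, ∑ l, c k * c l * ∫ p, signedMark (a k) (b k) p * signedMark (a l) (b l) p ∂μ := by
  have hi k l : Integrable (fun p => c k * c l
      * (signedMark (a k) (b k) p * signedMark (a l) (b l) p)) μ :=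
    ((hμ.memLp_signedMark _ _).integrable_mul (hμ.memLp_signedMark _ _)).const_mul _
  simp only [← integral_const_mul]
  rw [← integral_congr_ae (ae_of_all _ fun p => ?_), integral_finsetSum _ fun k _ =>
    integrable_finsetSum _ fun l _ => hi k l]
  · exact Finset.sum_congr rfl fun k _ => integral_finsetSum _ fun l _ => hi k l
  · rw [sq, Finset.sum_mul_sum]
    exact Finset.sum_congr rfl fun k _ => Finset.sum_congr rfl fun l _ => by ring

namespace IsLevyChentsovField

variable {Ω : Type*} [MeasurableSpace Ω] {η : ℝ × ℝ → Ω → ℝ} {d : ℝ × ℝ → ℝ × ℝ → ℝ}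
  {Q : Measure Ω}

lemma memLp_two (hη : IsLevyChentsovField η d Q) (a : ℝ × ℝ) : MemLp (η a) 2 Q :=
  (hη.isGaussianProcess.hasGaussianLaw_eval a).memLp_two

lemma hasGaussianLaw_sum_increments (hη : IsLevyChentsovField η d Q) {K : Type*} [Fintype K]
    (a b : K → ℝ × ℝ) (c : K → ℝ) :
    HasGaussianLaw (fun ω => ∑ k, c k * (η (b k) ω - η (a k) ω)) Q := by
  classical
  have hinc : IsGaussianProcess (fun (k : K) ω => η (b k) ω - η (a k) ω) Q :=
    hη.isGaussianProcess.of_isGaussianProcess fun k => ⟨{a k, b k},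
      (ContinuousLinearMap.proj ⟨b k, by simp⟩ - ContinuousLinearMap.proj ⟨a k, by simp⟩ :
        (({a k, b k} : Finset (ℝ × ℝ)) → ℝ) →L[ℝ] ℝ), fun ω => by simp⟩
  exact (hinc.smul c).hasGaussianLaw_fun_sum

lemma covariance_increments [IsFiniteMeasure Q] (hη : IsLevyChentsovField η d Q)
    (a b a' b' : ℝ × ℝ) :
    cov[fun ω => η b ω - η a ω, fun ω => η b' ω - η a' ω; Q]
      = (d b a' + d a b' - d b b' - d a a') / 2 := by
  rw [covariance_fun_sub_fun_sub (hη.memLp_two _) (hη.memLp_two _) (hη.memLp_two _) (hη.memLp_two _)]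
  simp only [hη.covariance_eq]
  ring

lemma charFun_sum_increments [IsProbabilityMeasure Q] {μ : Measure Particle}
    (hημ : IsAdmissible μ) (hd : ∀ a : ℝ × ℝ, crossingDist μ a a = 0)
    (hη : IsLevyChentsovField η (crossingDist μ) Q) {K : Type*} [Fintype K]
    (a b : K → ℝ × ℝ) (c : K → ℝ) :
    ∫ ω, Complex.exp ((∑ k, c k * (η (b k) ω - η (a k) ω) : ℝ) * Complex.I) ∂Q
      = Complex.exp (-((∫ p, (∑ k, c k * signedMark (a k) (b k) p) ^ 2 ∂μ : ℝ) : ℂ) / 2) := by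
  have hG := hη.hasGaussianLaw_sum_increments a b c
  have hinc k : MemLp (fun ω => η (b k) ω - η (a k) ω) 2 Q :=
    (hη.memLp_two (b k)).sub (hη.memLp_two (a k))
  have hmean : ∫ ω, ∑ k, c k * (η (b k) ω - η (a k) ω) ∂Q = 0 := by
    rw [integral_finsetSum _ fun k _ => ((hinc k).integrable (by norm_num)).const_mul _]
    refine Finset.sum_eq_zero fun k _ => ?_
    rw [integral_const_mul, integral_sub ((hη.memLp_two _).integrable (by norm_num))
      ((hη.memLp_two _).integrable (by norm_num)), hη.centered, hη.centered]
    simp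
  have hvar : Var[fun ω => ∑ k, c k * (η (b k) ω - η (a k) ω); Q]
      = ∫ p, (∑ k, c k * signedMark (a k) (b k) p) ^ 2 ∂μ := by
    rw [integral_sum_smul_signedMark_sq hημ, ← covariance_self hG.aemeasurable,
      covariance_fun_sum_fun_sum (fun k => (hinc k).const_mul _) (fun k => (hinc k).const_mul _)]
    refine Finset.sum_congr rfl fun k _ => Finset.sum_congr rfl fun l _ => ?_
    rw [covariance_const_mul_left, covariance_const_mul_right, hη.covariance_increments,
      integral_signedMark_mul hημ hd]
    ring
  have hchar := hG.charFun_map_eq 1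
  rw [charFun_apply_real, integral_map hG.aemeasurable (by fun_prop)] at hchar
  simpa [hmean, hvar, neg_div] using hchar

end IsLevyChentsovField

/-! ### Convergence in law of finitely many increments -/

lemma support_sum_signedMark_subset {K : Type*} [Fintype K] (a b : K → ℝ × ℝ) (c : K → ℝ) :
    (Function.support fun p => ∑ k, c k * signedMark (a k) (b k) p)
      ⊆ ⋃ k, crossing (a k) (b k) := by
  intro p hp
  obtain ⟨k, -, hk⟩ := Finset.exists_ne_zero_of_sum_ne_zero hp
  exact Set.mem_iUnion.2 ⟨k, support_signedMark_subset _ _ (right_ne_zero_of_mul hk)⟩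

/-- Convergence of characteristic functions implies convergence in distribution. -/
lemma tendstoInDistribution_of_tendsto_charFun {T : Type*} {l : Filter T}
    [l.IsCountablyGenerated] {E : Type*} [NormedAddCommGroup E] [InnerProductSpace ℝ E]
    [FiniteDimensional ℝ E] [MeasurableSpace E] [BorelSpace E]
    {Ω : T → Type*} [∀ i, MeasurableSpace (Ω i)] {P : ∀ i, Measure (Ω i)}
    [∀ i, IsProbabilityMeasure (P i)] {Ω' : Type*} [MeasurableSpace Ω'] {Q : Measure Ω'}
    [IsProbabilityMeasure Q] {X : ∀ i, Ω i → E} {Y : Ω' → E}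
    (hX : ∀ i, AEMeasurable (X i) (P i)) (hY : AEMeasurable Y Q)
    (h : ∀ w, Tendsto (fun i => charFun ((P i).map (X i)) w) l (𝓝 (charFun (Q.map Y) w))) :
    TendstoInDistribution X l Y P Q where
  forall_aemeasurable := hX
  aemeasurable_limit := hY
  tendsto := by
    -- Lévy's continuity theorem is applied along sequences, which suffice for a countably generated
    -- filter.
    refine tendsto_of_seq_tendsto fun u hu => ?_
    exact ProbabilityMeasure.tendsto_of_tendsto_charFun fun w => (h w).comp hu

/-- The central limit theorem for finitely many increments of the empirical measure. -/
theorem tendstoInDistribution_fluctuation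
    {μ : Measure Particle} (hμ : IsAdmissible μ)
    (hd : ∀ a : ℝ × ℝ, crossingDist μ a a = 0)
    {Ω : Set.Ioi (0 : ℝ) → Type*} [∀ ε, MeasurableSpace (Ω ε)]
    {P : ∀ ε, Measure (Ω ε)} [∀ ε, IsProbabilityMeasure (P ε)]
    {N : ∀ ε, Ω ε → Measure Particle}
    (hN : ∀ ε, IsPoissonProcess (N ε) (ENNReal.ofReal (ε : ℝ)⁻¹ • μ) (P ε))
    {Ω' : Type*} [MeasurableSpace Ω'] {Q : Measure Ω'} [IsProbabilityMeasure Q]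
    {η : ℝ × ℝ → Ω' → ℝ} (hη : IsLevyChentsovField η (crossingDist μ) Q)
    {K : Type*} [Fintype K] (a b : K → ℝ × ℝ) :
    TendstoInDistribution
      (fun (ε : Set.Ioi (0 : ℝ)) (ω : Ω ε) =>
        WithLp.toLp 2 fun k : K => fluctuation μ (N ε ω) ε (signedMark (a k) (b k)))
      (comap (Subtype.val : Set.Ioi (0 : ℝ) → ℝ) (𝓝 0))
      (fun ω : Ω' => WithLp.toLp 2 fun k : K => η (b k) ω - η (a k) ω)
      P Q := by
  have hΛ (ε : Set.Ioi (0 : ℝ)) {S : Set Particle} (hS : μ S < ∞) :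
      (ENNReal.ofReal (ε : ℝ)⁻¹ • μ) S < ∞ := by
    simpa using ENNReal.mul_lt_top ENNReal.ofReal_lt_top hS
  have hint (ε) (k : K) : ∀ᵐ ω ∂P ε, Integrable (signedMark (a k) (b k)) (N ε ω) :=
    (hN ε).integrable_ae (measurableSet_crossing _ _) (hΛ ε (hμ.measure_crossing_lt_top _ _))
      (by fun_prop) ((hμ.integrable_signedMark _ _).smul_measure ENNReal.ofReal_ne_top)
      (support_signedMark_subset _ _)
  have hXm (ε) : AEMeasurable (fun ω =>
      WithLp.toLp 2 fun k : K => fluctuation μ (N ε ω) ε (signedMark (a k) (b k))) (P ε) := by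
    refine (WithLp.measurable_toLp 2 (K → ℝ)).comp_aemeasurable
      (aemeasurable_pi_lambda _ fun k => ?_)
    have := (hN ε).aemeasurable_integral (by fun_prop) (hint ε k)
    unfold fluctuation
    fun_prop
  have hYm : AEMeasurable (fun ω => WithLp.toLp 2 fun k : K => η (b k) ω - η (a k) ω) Q := by
    refine (WithLp.measurable_toLp 2 (K → ℝ)).comp_aemeasurable
      (aemeasurable_pi_lambda _ fun k => ?_)
    exact (hη.isGaussianProcess.aemeasurable _).sub (hη.isGaussianProcess.aemeasurable _)
  refine tendstoInDistribution_of_tendsto_charFun hXm hYm fun w => ?_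
  set F : Particle → ℝ := fun p => ∑ k, w k * signedMark (a k) (b k) p with hF
  have hFm : Measurable F := by fun_prop
  have hF2 : MemLp F 2 μ :=
    memLp_finsetSum _ fun k _ => (hμ.memLp_signedMark (a k) (b k)).const_mul (w k)
  have hFi : Integrable F μ :=
    integrable_finsetSum _ fun k _ => (hμ.integrable_signedMark (a k) (b k)).const_mul (w k)
  have hSm : MeasurableSet (⋃ k, crossing (a k) (b k)) :=
    MeasurableSet.iUnion fun k => measurableSet_crossing _ _
  have hμS : μ (⋃ k, crossing (a k) (b k)) < ∞ :=
    (measure_iUnion_fintype_le _ _).trans_lt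
      (ENNReal.sum_lt_top.2 fun k _ => hμ.measure_crossing_lt_top _ _)
  have hY : charFun (Q.map fun ω => WithLp.toLp 2 fun k : K => η (b k) ω - η (a k) ω) w
      = Complex.exp (-((∫ p, F p ^ 2 ∂μ : ℝ) : ℂ) / 2) := by
    rw [charFun_apply, integral_map hYm (by fun_prop), ← hη.charFun_sum_increments hμ hd]
    rfl
  have hX (ε : Set.Ioi (0 : ℝ)) : charFun ((P ε).map fun ω =>
      WithLp.toLp 2 fun k : K => fluctuation μ (N ε ω) ε (signedMark (a k) (b k))) w
      = Complex.exp (∫ p, (Complex.exp ((√(ε : ℝ) * F p : ℝ) * Complex.I) - 1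
          - (√(ε : ℝ) * F p : ℝ) * Complex.I) / (√(ε : ℝ) : ℂ) ^ 2 ∂μ) := by
    rw [charFun_apply, integral_map (hXm ε) (by fun_prop),
      ← charFun_fluctuation ε.2 (hN ε) hSm hμS hFm hFi (support_sum_signedMark_subset a b w)]
    refine integral_congr_ae ?_
    filter_upwards [ae_all_iff.2 (hint ε)] with ω hω
    congr 3
    rw [fluctuation, hF, integral_finsetSum _ fun k _ => (hω k).const_mul _,
      integral_finsetSum _ fun k _ => (hμ.integrable_signedMark (a k) (b k)).const_mul _,
      Finset.mul_sum, ← Finset.sum_sub_distrib, Finset.mul_sum, PiLp.inner_apply]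
    refine Finset.sum_congr rfl fun k _ => ?_
    rw [integral_const_mul, integral_const_mul, Real.inner_apply]
    simp only [fluctuation]
    ring
  have hε : Tendsto (fun ε : Set.Ioi (0 : ℝ) => √(ε : ℝ)) (comap Subtype.val (𝓝 0)) (𝓝[>] 0) := by
    refine tendsto_nhdsWithin_iff.2 ⟨?_, Eventually.of_forall fun ε => Real.sqrt_pos.2 ε.2⟩
    have : Tendsto Real.sqrt (𝓝 0) (𝓝 0) := by
      simpa using Real.continuous_sqrt.tendsto 0
    exact this.comp tendsto_comap
  simp only [hX, hY]
  exact (Complex.continuous_exp.tendsto _).comp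
    ((tendsto_integral_exp_sub_one_sub hFm hF2).comp hε)

/-! ### From increments to quasi-particle positions -/

/-- The variance at the origin is `d(o, o)`. This turns the limiting increment `η(a) - η(o)` into
`η(a)`. -/
lemma IsLevyChentsovField.ae_eq_zero {Ω : Type*} [MeasurableSpace Ω] {η : ℝ × ℝ → Ω → ℝ}
    {d : ℝ × ℝ → ℝ × ℝ → ℝ} {Q : Measure Ω} [IsProbabilityMeasure Q]
    (hη : IsLevyChentsovField η d Q) (hd : d 0 0 = 0) : ∀ᵐ ω ∂Q, η 0 ω = 0 := by
  have hv : Var[η 0; Q] = 0 := by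
    rw [← covariance_self (hη.isGaussianProcess.aemeasurable 0), hη.covariance_eq, hd]
    norm_num
  simpa only [hη.centered] using ae_eq_integral_of_variance_eq_zero (hη.memLp_two 0) hv

lemma IsMarkless.rescale {ν : Measure Particle} {a : ℝ × ℝ} (h : IsMarkless ν a) (ε : ℝ) :
    IsMarkless (rescale ε ν) a :=
  Measure.ae_smul_measure h _

lemma IsPoissonProcess.ae_isMarkless {Ω : Type*} [MeasurableSpace Ω] {N : Ω → Measure Particle}
    {Λ : Measure Particle} {P : Measure Ω} (h : IsPoissonProcess N Λ P) {a : ℝ × ℝ}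
    (hΛ : Λ (crossing a a) < ∞) (ha : IsMarkless Λ a) : ∀ᵐ ω ∂P, IsMarkless (N ω) a := by
  refine h.ae_ae (measurableSet_crossing a a) hΛ ha fun p hp hpa => absurd ?_ hp
  rw [crossing_eq]
  simp [hpa]

lemma integral_rescale {ε : ℝ} (hε : 0 < ε) (ν : Measure Particle) (F : Particle → ℝ) :
    ∫ p, F p ∂rescale ε ν = ε * ∫ p, F p ∂ν := by
  rw [rescale, integral_smul_measure, ENNReal.toReal_ofReal hε.le, smul_eq_mul]

lemma quasiParticle_rescale_sub {μ ν : Measure Particle} (hμ : IsAdmissible μ)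
    (hd : ∀ a : ℝ × ℝ, crossingDist μ a a = 0) {ε : ℝ} (hε : 0 < ε) {x v t : ℝ}
    (h₀ : IsMarkless ν (x, 0)) (h₁ : IsMarkless ν (x + v * t, t))
    (hi : Integrable (signedMark 0 (x, 0)) ν)
    (hi' : Integrable (signedMark (x, 0) (x + v * t, t)) ν) :
    ε ^ (-(1 / 2) : ℝ) * (quasiParticle (rescale ε ν) x v t - quasiParticle μ x v t)
      = fluctuation μ ν ε (signedMark 0 (x + v * t, t)) := by
  rw [quasiParticle_eq (h₀.rescale ε) (h₁.rescale ε) (hi.smul_measure ENNReal.ofReal_ne_top)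
      (hi'.smul_measure ENNReal.ofReal_ne_top),
    quasiParticle_eq (hμ.isMarkless (hd _)) (hμ.isMarkless (hd _)) (hμ.integrable_signedMark _ _)
      (hμ.integrable_signedMark _ _), integral_rescale hε, add_sub_add_left_eq_sub, fluctuation]

end HardRod

theorem mainTheorem4
    (μ : Measure Particle) (hμ : IsAdmissible μ)
    (hd : ∀ a : ℝ × ℝ, crossingDist μ a a = 0)
    {Ω : Set.Ioi (0 : ℝ) → Type*} [∀ ε, MeasurableSpace (Ω ε)]
    (P : ∀ ε, Measure (Ω ε)) [∀ ε, IsProbabilityMeasure (P ε)]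
    (N : ∀ ε, Ω ε → Measure Particle)
    (hN : ∀ ε, IsPoissonProcess (N ε) (ENNReal.ofReal (ε : ℝ)⁻¹ • μ) (P ε))
    {Ω' : Type*} [MeasurableSpace Ω'] (Q : Measure Ω') [IsProbabilityMeasure Q]
    (η : ℝ × ℝ → Ω' → ℝ) (hη : IsLevyChentsovField η (crossingDist μ) Q)
    {ι κ : Type*} [Fintype ι] [Fintype κ]
    (x v t : ι → ℝ) (z s : κ → ℝ) :
    TendstoInDistribution
      (fun (ε : Set.Ioi (0 : ℝ)) (ω : Ω ε) =>
        ((fun i : ι => (ε : ℝ) ^ (-(1 / 2) : ℝ) *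
            (quasiParticle (rescale ε (N ε ω)) (x i) (v i) (t i)
              - quasiParticle μ (x i) (v i) (t i))),
          (fun j : κ => (ε : ℝ) ^ (-(1 / 2) : ℝ) *
            (ε * mass (evolve (s j) (N ε ω)) 0 (z j) - mass (evolve (s j) μ) 0 (z j)))))
      (comap (Subtype.val : Set.Ioi (0 : ℝ) → ℝ) (𝓝 0))
      (fun ω : Ω' =>
        ((fun i : ι => η (x i + v i * t i, t i) ω),
          (fun j : κ => η (z j, s j) ω - η (0, s j) ω)))
      P Q := by
  -- Indexing both families of increments by one sum type makes the convergence joint.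
  let a : ι ⊕ κ → ℝ × ℝ := Sum.elim (fun _ => 0) fun j => (0, s j)
  let b : ι ⊕ κ → ℝ × ℝ := Sum.elim (fun i => (x i + v i * t i, t i)) fun j => (z j, s j)
  let g : EuclideanSpace ℝ (ι ⊕ κ) → (ι → ℝ) × (κ → ℝ) := fun y =>
    (fun i => y (Sum.inl i), fun j => y (Sum.inr j))
  have hg : Continuous g := by fun_prop
  refine ((tendstoInDistribution_fluctuation hμ hd hN hη a b).continuous_comp hg).congr
    (fun ε => ?_) ?_
  · have hΛ (a b : ℝ × ℝ) : (ENNReal.ofReal (ε : ℝ)⁻¹ • μ) (crossing a b) < ∞ := by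
      simpa using ENNReal.mul_lt_top ENNReal.ofReal_lt_top (hμ.measure_crossing_lt_top a b)
    have hint (a b : ℝ × ℝ) : ∀ᵐ ω ∂P ε, Integrable (signedMark a b) (N ε ω) :=
      (hN ε).integrable_ae (measurableSet_crossing a b) (hΛ a b) (by fun_prop)
        ((hμ.integrable_signedMark a b).smul_measure ENNReal.ofReal_ne_top)
        (support_signedMark_subset a b)
    have hmark (a : ℝ × ℝ) : ∀ᵐ ω ∂P ε, IsMarkless (N ε ω) a :=
      (hN ε).ae_isMarkless (hΛ a a) (Measure.ae_smul_measure (hμ.isMarkless (hd a)) _)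
    filter_upwards [ae_all_iff.2 fun i => hmark (x i, 0),
      ae_all_iff.2 fun i => hmark (x i + v i * t i, t i), ae_all_iff.2 fun i => hint 0 (x i, 0),
      ae_all_iff.2 fun i => hint (x i, 0) (x i + v i * t i, t i)] with ω h₀ h₁ hi hi'
    refine Prod.ext (funext fun i => ?_) (funext fun j => ?_)
    · exact (quasiParticle_rescale_sub hμ hd ε.2 (h₀ i) (h₁ i) (hi i) (hi' i)).symm
    · simp only [mass_evolve_eq]
      rfl
  · filter_upwards [hη.ae_eq_zero (hd 0)] with ω hω
    refine Prod.ext (funext fun i => ?_) rfl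
    change η (x i + v i * t i, t i) ω - η 0 ω = _
    rw [hω, sub_zero]
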